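/- Let $I=[0,\alpha)$ with $\alpha=1$ or $\alpha=\infty$, let $\mu$ be Lebesgue measure on $I$, and let $L^0$ be the space of (classes of $\mu$-a.e. equal) measurable functions on $I$. A Banach function space is a linear subspace $E\subset L^0$ with a complete norm $\|\cdot\|_E$ such that $E$ contains a strictly positive function and such that $x\in L^0$, $y\in E$, $|x|\le|y|$ a.e. imply $x\in E$ and $\|x\|_E\le\|y\|_E$. For $x\in L^0$ put $d_x(\lambda)=\mu\{s\in I:|x(s)|>\lambda\}$ for $\lambda\ge 0$ and $x^*(t)=\inf\{\lambda>0:d_x(\lambda)\le t\}$ for $t\ge 0$ (with $\inf\emptyset=\infty$); put $x^*(\infty)=\lim_{t\to\infty}x^*(t)$ if $\alpha=\infty$ and $x^*(\infty)=0$ if $\alpha=1$. The space $E$ is symmetric if $x\in L^0$, $y\in E$, $d_x=d_y$ imply $x\in E$ and $\|x\|_E=\|y\|_E$. It has the Fatou property if, whenever $x_n\in E$, $0\le x_n\uparrow x\in L^0$ a.e. and $\sup_n\|x_n\|_E<\infty$, one has $x\in E$ and $\|x_n\|_E\uparrow\|x\|_E$. An element $x\in E$ is an $H_g$ point if for every sequence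 $(x_n)\subset E$ such that $x_n\to x$ globally in measure (that is, $\mu\{|x_n-x|\ge\varepsilon\}\to 0$ for every $\varepsilon>0$) and $\|x_n\|_E\to\|x\|_E$, one has $\|x_n-x\|_E\to 0$. It is a point of order continuity if for every sequence $(x_n)\subset E$ with $0\le x_n\le|x|$ a.e. and $x_n\to 0$ a.e., one has $\|x_n\|_E\to 0$. Proposition. Let $E$ be a symmetric space on $I$ with the Fatou property, and let $x\in E$ satisfy $x^*(\infty)=0$. If $x$ is an $H_g$ point of $E$, then $x$ is a point of order continuity of $E$. -/

import Mathlib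

open MeasureTheory Filter Topology
open scoped NNReal ENNReal

noncomputable section

/-- Lebesgue measure on the interval `I = [0, α)`, seen as a measure on `ℝ` that vanishes off `I`.
The cases of interest are `α = 1` and `α = ∞`. -/
def intervalMeasure (α : ℝ≥0∞) : Measure ℝ :=
  (volume : Measure ℝ).restrict {t : ℝ | 0 ≤ t ∧ ENNReal.ofReal t < α}

/-- Classes, modulo equality almost everywhere, of measurable functions on `I = [0, α)`.
Real values suffice: since the norm is homogeneous and monotone and vanishes only at `0`, every
element of a Banach function space is finite almost everywhere. -/
abbrev LZero (α : ℝ≥0∞) : Type := ℝ →ₘ[intervalMeasure α] ℝ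

/-- The distribution function `d_x(r) = μ {s ∈ I : |x(s)| > r}`, `r ≥ 0`. -/
def distributionFunction {α : ℝ≥0∞} (x : LZero α) (r : ℝ≥0) : ℝ≥0∞ :=
  intervalMeasure α {s : ℝ | (r : ℝ) < |x s|}

/-- The decreasing rearrangement `x*(t) = inf {r > 0 : d_x(r) ≤ t}`, `t ≥ 0`
(with `inf ∅ = ∞`). -/
def decreasingRearrangement {α : ℝ≥0∞} (x : LZero α) (t : ℝ≥0) : ℝ≥0∞ :=
  ⨅ (r : ℝ≥0) (_ : 0 < r ∧ distributionFunction x r ≤ (t : ℝ≥0∞)), (r : ℝ≥0∞)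

/-- The value `x*(∞)`: the limit of the decreasing function `x*` at infinity if `α = ∞`,
and `0` otherwise. -/
def rearrangementAtInfty {α : ℝ≥0∞} (x : LZero α) : ℝ≥0∞ :=
  if α = ∞ then ⨅ t : ℝ≥0, decreasingRearrangement x t else 0

theorem decreasingRearrangement_antitone {α : ℝ≥0∞} (x : LZero α) :
    Antitone (decreasingRearrangement x) := by
  intro s t hst
  refine le_iInf₂ fun r hr => iInf₂_le r ⟨hr.1, hr.2.trans ?_⟩
  exact_mod_cast hst

/-- For `α = ∞` the value `x*(∞)` is indeed the limit of `x*` at infinity. -/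
theorem tendsto_decreasingRearrangement (x : LZero ∞) :
    Tendsto (decreasingRearrangement x) atTop (𝓝 (rearrangementAtInfty x)) := by
  rw [rearrangementAtInfty, if_pos rfl]
  exact tendsto_atTop_iInf (decreasingRearrangement_antitone x)

/-- Two functions are equimeasurable if they have the same distribution function. -/
def Equimeasurable {α : ℝ≥0∞} (x y : LZero α) : Prop :=
  distributionFunction x = distributionFunction y

/-- A Banach function space on `I = [0, α)`: a linear subspace `carrier` of the measurable
functions with a complete norm, which is solid (hence a sublattice, with a monotone norm) and
contains a strictly positive function. -/
structure BanachFunctionSpace (α : ℝ≥0∞) where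
  carrier : Submodule ℝ (LZero α)
  nrm : Seminorm ℝ carrier
  eq_zero_of_nrm_eq_zero : ∀ x : carrier, nrm x = 0 → x = 0
  complete : ∀ u : ℕ → carrier,
    (∀ ε : ℝ, 0 < ε → ∃ N : ℕ, ∀ m ≥ N, ∀ n ≥ N, nrm (u m - u n) < ε) →
    ∃ x : carrier, Tendsto (fun n => nrm (u n - x)) atTop (𝓝 0)
  solid : ∀ (x : LZero α) (y : carrier), |x| ≤ |(y : LZero α)| →
    ∃ hx : x ∈ carrier, nrm ⟨x, hx⟩ ≤ nrm y
  exists_pos : ∃ x : carrier, ∀ᵐ t ∂(intervalMeasure α), 0 < (x : LZero α) t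

/-- A symmetric (rearrangement invariant) space on `I = [0, α)`. -/
structure SymmetricSpace (α : ℝ≥0∞) extends BanachFunctionSpace α where
  symmetric : ∀ (x : LZero α) (y : carrier), Equimeasurable x (y : LZero α) →
    ∃ hx : x ∈ carrier, nrm ⟨x, hx⟩ = nrm y

namespace BanachFunctionSpace

variable {α : ℝ≥0∞} (E : BanachFunctionSpace α)

/-- The Fatou property: if `0 ≤ x_n ↑ x` almost everywhere, where the `x_n` are elements of `E`
with bounded norms, then `x ∈ E` and `‖x_n‖ → ‖x‖` (increasingly, the norm being monotone). -/
def HasFatouProperty : Prop :=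
  ∀ (u : ℕ → E.carrier) (x : LZero α),
    (∀ n, (0 : LZero α) ≤ (u n : LZero α)) →
    Monotone (fun n => (u n : LZero α)) →
    BddAbove (Set.range fun n => E.nrm (u n)) →
    (∀ᵐ t ∂(intervalMeasure α), Tendsto (fun n => (u n : LZero α) t) atTop (𝓝 (x t))) →
    ∃ hx : x ∈ E.carrier, Tendsto (fun n => E.nrm (u n)) atTop (𝓝 (E.nrm ⟨x, hx⟩))

/-- `x` is an `H_g` point: if `x_n → x` globally in measure and `‖x_n‖ → ‖x‖`, then
`‖x_n - x‖ → 0`. -/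
def IsHgPoint (x : E.carrier) : Prop :=
  ∀ u : ℕ → E.carrier,
    TendstoInMeasure (intervalMeasure α) (fun n t => (u n : LZero α) t) atTop
      (fun t => (x : LZero α) t) →
    Tendsto (fun n => E.nrm (u n)) atTop (𝓝 (E.nrm x)) →
    Tendsto (fun n => E.nrm (u n - x)) atTop (𝓝 0)

/-- `x` is a point of order continuity: if `0 ≤ x_n ≤ |x|` and `x_n → 0` almost everywhere, then
`‖x_n‖ → 0`. -/
def IsPointOfOrderContinuity (x : E.carrier) : Prop :=
  ∀ u : ℕ → E.carrier,
    (∀ n, (0 : LZero α) ≤ (u n : LZero α)) →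
    (∀ n, (u n : LZero α) ≤ |(x : LZero α)|) →
    (∀ᵐ t ∂(intervalMeasure α), Tendsto (fun n => (u n : LZero α) t) atTop (𝓝 0)) →
    Tendsto (fun n => E.nrm (u n)) atTop (𝓝 0)

end BanachFunctionSpace

end

/-! Given `0 ≤ u n ≤ |x|` with `u n → 0` a.e., shrink `x` towards zero by `u n`, keeping its sign:
this gives `y n` with `|y n| = |x| - u n` and `|y n - x| = u n`. Then `y n → x` a.e. with error at
most `|x|`. Since `x*(∞) = 0`, the level sets of `|x|` at positive heights have finite measure, so
convergence is global in measure. As `|y n| ≤ |x|`, the Fatou property gives convergence of the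
norms. The `H_g` property then yields `‖u n‖ = ‖y n - x‖ → 0`. -/

instance LZero.instAddLeftMono (α : ℝ≥0∞) : AddLeftMono (LZero α) :=
  ⟨fun x y z h => AEEqFun.coeFn_le.1 <| by
    filter_upwards [AEEqFun.coeFn_le.2 h, AEEqFun.coeFn_add x y, AEEqFun.coeFn_add x z]
      with t h1 h2 h3
    change (x + y : LZero α) t ≤ (x + z : LZero α) t
    rw [h2, h3, Pi.add_apply, Pi.add_apply]
    exact add_le_add_right h1 _⟩

theorem distributionFunction_ne_top {α : ℝ≥0∞} (hα : α = 1 ∨ α = ∞) {x : LZero α}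
    (hx : rearrangementAtInfty x = 0) {r : ℝ≥0} (hr : 0 < r) :
    distributionFunction x r ≠ ∞ := by
  rcases hα with rfl | rfl
  · refine ((measure_mono (Set.subset_univ _)).trans_lt ?_).ne
    have hsub : {t : ℝ | 0 ≤ t ∧ ENNReal.ofReal t < 1} ⊆ Set.Icc 0 1 := fun t ht =>
      ⟨ht.1, (ENNReal.ofReal_lt_one.1 ht.2).le⟩
    rw [intervalMeasure, Measure.restrict_apply_univ]
    exact (measure_mono hsub).trans_lt measure_Icc_lt_top
  · rw [rearrangementAtInfty, if_pos rfl] at hx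
    obtain ⟨t, ht⟩ := iInf_lt_iff.1 (hx.trans_lt (ENNReal.coe_pos.2 hr))
    obtain ⟨s, hs⟩ := iInf_lt_iff.1 ht
    obtain ⟨hst, hsr⟩ := iInf_lt_iff.1 hs
    refine ((measure_mono fun a ha => ?_).trans_lt (hst.2.trans_lt ENNReal.coe_lt_top)).ne
    have hsr' : (s : ℝ) < r := NNReal.coe_lt_coe.2 (ENNReal.coe_lt_coe.1 hsr)
    exact hsr'.trans ha

/-- Dominated convergence in measure, for a dominating function all of whose level sets at positive
heights have finite measure. -/
theorem tendstoInMeasure_of_dominated {Ω : Type*} {m : MeasurableSpace Ω} {μ : Measure Ω}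
    {f : ℕ → Ω → ℝ} {g : Ω → ℝ} {b : Ω → ℝ} (hf : ∀ n, AEStronglyMeasurable (f n) μ)
    (hb : ∀ r : ℝ≥0, 0 < r → μ {a | (r : ℝ) < b a} ≠ ∞)
    (hle : ∀ n, ∀ᵐ a ∂μ, |f n a - g a| ≤ b a)
    (hlim : ∀ᵐ a ∂μ, Tendsto (fun n => f n a) atTop (𝓝 (g a))) :
    TendstoInMeasure μ f atTop g := by
  rw [tendstoInMeasure_iff_norm]
  intro ε hε
  -- An error of at least `ε` forces `b ≥ ε > ε / 2`, so all the exceptional sets lie in the single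
  -- finite-measure set `S`; halving `ε` absorbs the strict inequality.
  set S : Set Ω := {a | ((⟨ε / 2, by positivity⟩ : ℝ≥0) : ℝ) < b a} with hS
  have : IsFiniteMeasure (μ.restrict S) :=
    ⟨by rw [Measure.restrict_apply_univ]; exact (hb ⟨ε / 2, _⟩ (NNReal.coe_pos.1 (half_pos hε))).lt_top⟩
  have h := tendstoInMeasure_of_tendsto_ae (μ := μ.restrict S) (fun n => (hf n).restrict)
    (ae_restrict_of_ae hlim)
  rw [tendstoInMeasure_iff_norm] at h
  refine tendsto_of_tendsto_of_tendsto_of_le_of_le tendsto_const_nhds (h ε hε)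
    (fun _ => zero_le) fun n => ?_
  refine le_trans (measure_mono_ae ?_) (Measure.le_restrict_apply S _)
  filter_upwards [hle n] with a ha hεa
  refine ⟨hεa, ?_⟩
  have hεa' : ε ≤ |f n a - g a| := hεa
  change ε / 2 < b a
  linarith

namespace BanachFunctionSpace

variable {α : ℝ≥0∞} {E : BanachFunctionSpace α}

theorem nrm_le_of_abs_le {x y : E.carrier} (h : |(x : LZero α)| ≤ |(y : LZero α)|) :
    E.nrm x ≤ E.nrm y :=
  (E.solid x y h).2

/-- Under the Fatou property, order bounded convergence almost everywhere from below implies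
convergence of the norms. -/
theorem HasFatouProperty.tendsto_nrm (hE : E.HasFatouProperty) {w : ℕ → E.carrier} {z : E.carrier}
    (hw : ∀ n, (0 : LZero α) ≤ (w n : LZero α)) (hwz : ∀ n, (w n : LZero α) ≤ (z : LZero α))
    (hlim : ∀ᵐ t ∂(intervalMeasure α),
      Tendsto (fun n => (w n : LZero α) t) atTop (𝓝 ((z : LZero α) t))) :
    Tendsto (fun n => E.nrm (w n)) atTop (𝓝 (E.nrm z)) := by
  -- The tail infima of `w` increase to `z`, so Fatou applies to them, and their norms squeeze `‖w
  -- n‖` from below against `‖z‖`.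
  have hmeas : ∀ n, AEStronglyMeasurable (fun t => ⨅ k, (w (n + k) : LZero α) t)
      (intervalMeasure α) := fun n =>
    (AEMeasurable.iInf fun k => (w (n + k) : LZero α).aemeasurable).aestronglyMeasurable
  let v : ℕ → LZero α := fun n => AEEqFun.mk _ (hmeas n)
  have hv : ∀ n, v n =ᵐ[intervalMeasure α] fun t => ⨅ k, (w (n + k) : LZero α) t :=
    fun n => AEEqFun.coeFn_mk _ _
  have hpos : ∀ᵐ t ∂(intervalMeasure α), ∀ n, 0 ≤ (w n : LZero α) t := ae_all_iff.2 fun n => by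
    filter_upwards [AEEqFun.coeFn_le.2 (hw n), AEEqFun.coeFn_zero (β := ℝ)] with t ht h0
    rwa [h0] at ht
  have hbdd : ∀ {t : ℝ}, (∀ n, 0 ≤ (w n : LZero α) t) → ∀ n,
      BddBelow (Set.range fun k => (w (n + k) : LZero α) t) := fun h n =>
    ⟨0, by rintro _ ⟨k, rfl⟩; exact h _⟩
  have hv0 : ∀ n, 0 ≤ v n := fun n => AEEqFun.coeFn_le.1 <| by
    filter_upwards [hv n, hpos, AEEqFun.coeFn_zero (β := ℝ)] with t ht hp h0
    rw [ht, h0]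
    exact le_ciInf fun k => hp _
  have hvw : ∀ n, v n ≤ (w n : LZero α) := fun n => AEEqFun.coeFn_le.1 <| by
    filter_upwards [hv n, hpos] with t ht hp
    rw [ht]
    exact ciInf_le (hbdd hp n) 0
  have hmono : Monotone v := monotone_nat_of_le_succ fun n => AEEqFun.coeFn_le.1 <| by
    filter_upwards [hv n, hv (n + 1), hpos] with t ht ht' hp
    rw [ht, ht']
    refine le_ciInf fun k => ?_
    have := ciInf_le (hbdd hp n) (1 + k)
    rwa [← add_assoc] at this
  have hvabs : ∀ n, |v n| ≤ |(w n : LZero α)| := fun n => by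
    rw [abs_of_nonneg (hv0 n), abs_of_nonneg (hw n)]
    exact hvw n
  have hwn : ∀ n, E.nrm (w n) ≤ E.nrm z := fun n => nrm_le_of_abs_le <| by
    rw [abs_of_nonneg (hw n), abs_of_nonneg ((hw n).trans (hwz n))]
    exact hwz n
  have hvlim : ∀ᵐ t ∂(intervalMeasure α),
      Tendsto (fun n => v n t) atTop (𝓝 ((z : LZero α) t)) := by
    filter_upwards [ae_all_iff.2 hv, hpos, hlim] with t ht hp hl
    refine Metric.tendsto_atTop.2 fun ε hε => ?_
    obtain ⟨N, hN⟩ := Metric.tendsto_atTop.1 hl (ε / 2) (half_pos hε)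
    refine ⟨N, fun n hn => ?_⟩
    rw [ht n, Real.dist_eq, abs_lt]
    have hlow : (z : LZero α) t - ε / 2 ≤ ⨅ k, (w (n + k) : LZero α) t := le_ciInf fun k => by
      have := hN (n + k) (hn.trans (Nat.le_add_right n k))
      rw [Real.dist_eq, abs_lt] at this
      linarith
    have hup : ⨅ k, (w (n + k) : LZero α) t ≤ (w n : LZero α) t := ciInf_le (hbdd hp n) 0
    have := hN n hn
    rw [Real.dist_eq, abs_lt] at this
    constructor <;> linarith
  obtain ⟨_, hz⟩ := hE (fun n => ⟨v n, (E.solid _ _ (hvabs n)).1⟩) z hv0 hmono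
    ⟨E.nrm z, by
      rintro _ ⟨n, rfl⟩
      exact (E.solid _ _ (hvabs n)).2.trans (hwn n)⟩ hvlim
  exact tendsto_of_tendsto_of_tendsto_of_le_of_le hz tendsto_const_nhds
    (fun n => (E.solid _ _ (hvabs n)).2) hwn

end BanachFunctionSpace

/-- Truncating `x` in modulus to the height `|x| - u` changes it by exactly `u`. -/
theorem LZero.exists_abs_eq_abs_sub {α : ℝ≥0∞} {x u : LZero α} (hu : 0 ≤ u) (hux : u ≤ |x|) :
    ∃ y : LZero α, |y| = |x| - u ∧ |y - x| = u := by
  -- Clamping `x` to `[-(|x| - u), |x| - u]` gives `x - u` where `x ≥ 0` and `x + u` where `x ≤ 0`.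
  have key : ∀ᵐ t ∂(intervalMeasure α), ∀ y : ℝ, y = (x t ⊓ (|x t| - u t)) ⊔ -(|x t| - u t) →
      |y| = |x t| - u t ∧ |y - x t| = u t := by
    filter_upwards [AEEqFun.coeFn_le.2 hu, AEEqFun.coeFn_le.2 hux, AEEqFun.coeFn_zero (β := ℝ),
      AEEqFun.coeFn_abs x] with t h1 h2 h0 h3 y hy
    rw [h0, Pi.zero_apply] at h1
    rw [h3] at h2
    rcases le_total 0 (x t) with hx | hx
    · rw [abs_of_nonneg hx] at *
      rw [inf_of_le_right (by linarith), sup_of_le_left (by linarith)] at hy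
      rw [hy, abs_of_nonneg (by linarith), abs_of_nonpos (by linarith)]
      exact ⟨rfl, by ring⟩
    · rw [abs_of_nonpos hx] at *
      rw [inf_of_le_left (by linarith), sup_of_le_right (by linarith)] at hy
      rw [hy, abs_of_nonpos (by linarith), abs_of_nonneg (by linarith)]
      exact ⟨by ring, by ring⟩
  refine ⟨(x ⊓ (|x| - u)) ⊔ -(|x| - u), AEEqFun.ext ?_, AEEqFun.ext ?_⟩
  all_goals
    filter_upwards [key, AEEqFun.coeFn_abs x, AEEqFun.coeFn_sub |x| u,
      AEEqFun.coeFn_neg (|x| - u), AEEqFun.coeFn_inf x (|x| - u),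
      AEEqFun.coeFn_sup (x ⊓ (|x| - u)) (-(|x| - u)),
      AEEqFun.coeFn_abs ((x ⊓ (|x| - u)) ⊔ -(|x| - u)),
      AEEqFun.coeFn_sub ((x ⊓ (|x| - u)) ⊔ -(|x| - u)) x,
      AEEqFun.coeFn_abs ((x ⊓ (|x| - u)) ⊔ -(|x| - u) - x)] with t hk h1 h2 h3 h4 h5 h6 h7 h8
    simp only [Pi.sub_apply, Pi.neg_apply] at h2 h3 h7
    have := hk (((x ⊓ (|x| - u)) ⊔ -(|x| - u) : LZero α) t) (by rw [h5, h4, h3, h2, h1])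
  · rw [h6, h2, h1, this.1]
  · rw [h8, h7, this.2]

theorem mainTheorem6 (α : ℝ≥0∞) (hα : α = 1 ∨ α = ∞) (E : SymmetricSpace α)
    (hE : E.HasFatouProperty) (x : E.carrier)
    (hx : rearrangementAtInfty (x : LZero α) = 0) (hxg : E.IsHgPoint x) :
    E.IsPointOfOrderContinuity x := by
  intro u hu hux hlim
  choose y hy hyx using fun n => LZero.exists_abs_eq_abs_sub (hu n) (hux n)
  have hyle : ∀ n, |y n| ≤ |(x : LZero α)| := fun n => by
    rw [hy n]; exact sub_le_self _ (hu n)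
  let z : ℕ → E.carrier := fun n => ⟨y n, (E.solid _ _ (hyle n)).1⟩
  have habs : ∀ c : E.carrier, ∃ h : |(c : LZero α)| ∈ E.carrier,
      E.nrm ⟨|(c : LZero α)|, h⟩ = E.nrm c := fun c =>
    ⟨(E.solid |(c : LZero α)| c (abs_abs _).le).1,
      le_antisymm (E.solid |(c : LZero α)| c (abs_abs _).le).2
        (BanachFunctionSpace.nrm_le_of_abs_le (abs_abs _).ge)⟩
  have hzx : ∀ n, |((z n - x : E.carrier) : LZero α)| = u n := hyx
  have hdiff : ∀ᵐ t ∂(intervalMeasure α), ∀ n,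
      |y n t - (x : LZero α) t| = (u n : LZero α) t := ae_all_iff.2 fun n => by
    filter_upwards [AEEqFun.coeFn_abs (y n - (x : LZero α)), AEEqFun.coeFn_sub (y n) (x : LZero α)]
      with t h1 h2
    rw [hyx n] at h1
    rw [h1, h2, Pi.sub_apply]
  have hylim : ∀ᵐ t ∂(intervalMeasure α),
      Tendsto (fun n => y n t) atTop (𝓝 ((x : LZero α) t)) := by
    filter_upwards [hdiff, hlim] with t ht hl
    rw [tendsto_iff_norm_sub_tendsto_zero]
    simpa only [Real.norm_eq_abs, ht] using hl
  have hmeasure : TendstoInMeasure (intervalMeasure α) (fun n t => (z n : LZero α) t) atTop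
      (fun t => (x : LZero α) t) := by
    refine tendstoInMeasure_of_dominated (b := fun t => |(x : LZero α) t|)
      (fun n => (y n).aestronglyMeasurable)
      (fun r hr => distributionFunction_ne_top hα hx hr) (fun n => ?_) hylim
    filter_upwards [hdiff, AEEqFun.coeFn_le.2 (hux n), AEEqFun.coeFn_abs (x : LZero α)]
      with t h1 h2 h3
    rwa [← h1 n, h3] at h2
  have hnorm : Tendsto (fun n => E.nrm (z n)) atTop (𝓝 (E.nrm x)) := by
    -- The Fatou argument needs nonnegative functions, so it is run on moduli, which have the same
    -- norms.
    have h := BanachFunctionSpace.HasFatouProperty.tendsto_nrm hE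
      (w := fun n => ⟨|y n|, (habs (z n)).1⟩) (z := ⟨|(x : LZero α)|, (habs x).1⟩)
      (fun n => abs_nonneg _) hyle (by
        filter_upwards [hylim, ae_all_iff.2 fun n => AEEqFun.coeFn_abs (y n),
          AEEqFun.coeFn_abs (x : LZero α)] with t hl h1 h2
        simp only [h1, h2]
        exact hl.abs)
    rw [(habs x).2] at h
    exact h.congr fun n => (habs (z n)).2
  refine squeeze_zero (fun n => apply_nonneg _ _) (fun n => ?_) (hxg z hmeasure hnorm)
  exact BanachFunctionSpace.nrm_le_of_abs_le (by rw [hzx n, abs_of_nonneg (hu n)])
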